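/- **Definitions.** For real $\nu,x\ge 0$ let $I_\nu(x)=\sum_{k\ge0}\frac{1}{k!\,\Gamma(k+\nu+1)}\left(\frac x2\right)^{2k+\nu}$ be the modified Bessel function of the first kind, and let $\alpha_0=-\log(\sqrt2-1)$. Write $B$ for the Beta function, $[x]$ for the floor of $x$, $\nu_f=\nu-[\nu]$, and $F(\nu,x)=\dfrac{x}{\nu+\sqrt{\nu^2+x^2}}$. If $[\nu]+2\le[x]$, put $$\mathcal L(\nu,x)=\frac{2xe^{-\frac1x(\nu+1)}}{\nu+\frac32+\sqrt{(\nu+\frac32)^2+4x}}-\frac{2xe^{-\frac1{2x}([x]-\nu-\nu_f+1)([x]+\nu-\nu_f+2)}}{[x]+\frac32+\sqrt{([x]+\frac32)^2+\frac{8x}{\pi}}}+e^{-\frac{([x]-[\nu]-1)([x]+\nu+\nu_f)}{2x}}F([x]+\nu_f,x)\bigl(1+F([x]+\nu_f+1,x)\bigr),$$ $$\mathcal U(\nu,x)=\frac{2x}{\alpha_0}\left[\frac1{\nu+\sqrt{\nu^2+\frac{8x}{\pi\alpha_0}}}-\frac{e^{-\frac{\alpha_0}{2x}(x^2-\nu^2)}}{x+\sqrt{x^2+\frac{4x}{\alpha_0}}}\right]+e^{-\frac{\alpha_0}{2x}([x]-[\nu]-1)([x]+\nu+\nu_f-1)}\frac{F([x]+\nu_f-\frac12,x)}{1-F([x]+\nu_f+\frac12,x)},$$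 and if $[\nu]+2>[x]$, put $$\mathcal L(\nu,x)=F(\nu+1,x)\bigl(1+F(\nu+2,x)\bigr),\qquad \mathcal U(\nu,x)=\frac{F(\nu+\frac12,x)}{1-F(\nu+\frac32,x)}.$$ **Theorem.** Let $\nu\ge0$ be an integer and $x\ge0$ a real number. (When $x=0$, the exponents with denominator $2x$ below, which are then of the form $0/0$, are read as $0$.) 1. If $\nu\le x$, then $$\frac{\exp\left(-\frac{\nu(\nu+1)}{2x}\right)}{1+2\,\mathcal U(0,x)}\le e^{-x}I_\nu(x)\le\frac{\exp\left(-\frac{\alpha_0\nu^2}{2x}\right)}{1+2\,\mathcal L(0,x)}.$$ 2. If $\nu>x$, then $$\frac{e^{-\frac{[x]([x]+1)}{2x}}\,B\left([x]+\frac x2+1,\nu-[x]\right)\frac{(x/2)^{\nu-[x]}}{(\nu-[x]-1)!}}{1+2\,\mathcal U(0,x)}\le e^{-x}I_\nu(x)\le\frac{e^{-\frac{\alpha_0}{2x}[x]^2}\,B\left([x]+x+\frac12,\nu-[x]\right)\frac{x^{\nu-[x]}}{(\nu-[x]-1)!}}{1+2\,\mathcal L(0,x)}.$$ Consequently, if $W=X_1-X_2$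 with $X_1,X_2$ independent Poisson variables of parameters $\lambda_1,\lambda_2>0$ (that is, $W\sim\mathrm{Skellam}(\lambda_1,\lambda_2)$), then with $x=2\sqrt{\lambda_1\lambda_2}$ the probability $\mathbb P[W=\nu]$ is bounded below and above by the respective sides of (1) if $\nu\le x$, and of (2) if $\nu>x$, multiplied by $$\left(\sqrt{\lambda_1/\lambda_2}\right)^{\nu}\exp\left[-\left(\sqrt{\lambda_1}-\sqrt{\lambda_2}\right)^2\right].$$ -/

import Mathlib

open MeasureTheory ProbabilityTheory
open scoped Nat NNReal

noncomputable section

/-- The modified Bessel function of the first kind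
`I_ν(x) = ∑_{k ≥ 0} (x/2)^(2k+ν) / (k! Γ(k+ν+1))`, for real `ν, x ≥ 0`. -/
def besselI (ν x : ℝ) : ℝ :=
  ∑' k : ℕ, 1 / ((k ! : ℝ) * Real.Gamma (k + ν + 1)) * (x / 2) ^ (2 * (k : ℝ) + ν)

/-- The constant `α₀ = -log (√2 - 1) ≈ 0.8814`. -/
def alphaZero : ℝ := -Real.log (√2 - 1)

/-- `F(ν, x) = x / (ν + √(ν² + x²))`. -/
def amosF (ν x : ℝ) : ℝ := x / (ν + √(ν ^ 2 + x ^ 2))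

/-- The lower bound `𝓛(ν, x)` for `H(ν, x) = ∑_{k ≥ 1} I_{ν+k}(x) / I_ν(x)`: the Gaussian-type
expression if `[ν] + 2 ≤ [x]`, and the geometric-type bound otherwise. -/
def lowerH (ν x : ℝ) : ℝ :=
  if ⌊ν⌋ + 2 ≤ ⌊x⌋ then
    2 * x * Real.exp (-(1 / x) * (ν + 1)) / (ν + 3 / 2 + √((ν + 3 / 2) ^ 2 + 4 * x))
      - 2 * x * Real.exp (-(1 / (2 * x)) *
            ((⌊x⌋ - ν - Int.fract ν + 1) * (⌊x⌋ + ν - Int.fract ν + 2)))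
          / (⌊x⌋ + 3 / 2 + √((⌊x⌋ + 3 / 2) ^ 2 + 8 * x / Real.pi))
      + Real.exp (-((⌊x⌋ - ⌊ν⌋ - 1) * (⌊x⌋ + ν + Int.fract ν) / (2 * x)))
          * (amosF (⌊x⌋ + Int.fract ν) x * (1 + amosF (⌊x⌋ + Int.fract ν + 1) x))
  else
    amosF (ν + 1) x * (1 + amosF (ν + 2) x)

/-- The upper bound `𝓤(ν, x)` for `H(ν, x) = ∑_{k ≥ 1} I_{ν+k}(x) / I_ν(x)`: the Gaussian-type
expression if `[ν] + 2 ≤ [x]`, and the geometric-type bound otherwise. -/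
def upperH (ν x : ℝ) : ℝ :=
  if ⌊ν⌋ + 2 ≤ ⌊x⌋ then
    2 * x / alphaZero *
        (1 / (ν + √(ν ^ 2 + 8 * x / (Real.pi * alphaZero)))
          - Real.exp (-(alphaZero / (2 * x)) * (x ^ 2 - ν ^ 2))
              / (x + √(x ^ 2 + 4 * x / alphaZero)))
      + Real.exp (-(alphaZero / (2 * x)) *
            ((⌊x⌋ - ⌊ν⌋ - 1) * (⌊x⌋ + ν + Int.fract ν - 1)))
          * (amosF (⌊x⌋ + Int.fract ν - 1 / 2) x / (1 - amosF (⌊x⌋ + Int.fract ν + 1 / 2) x))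
  else
    amosF (ν + 1 / 2) x / (1 - amosF (ν + 3 / 2) x)

/-- Lower bound for `e^{-x} I_ν(x)` in the range `ν ≤ x`. -/
def gaussLower (ν : ℕ) (x : ℝ) : ℝ :=
  Real.exp (-((ν : ℝ) * (ν + 1) / (2 * x))) / (1 + 2 * upperH 0 x)

/-- Upper bound for `e^{-x} I_ν(x)` in the range `ν ≤ x`. -/
def gaussUpper (ν : ℕ) (x : ℝ) : ℝ :=
  Real.exp (-(alphaZero * (ν : ℝ) ^ 2 / (2 * x))) / (1 + 2 * lowerH 0 x)

/-- Lower bound for `e^{-x} I_ν(x)` in the range `ν > x` (where `ν - [x] ≥ 1`). -/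
def betaLower (ν : ℕ) (x : ℝ) : ℝ :=
  Real.exp (-((⌊x⌋₊ : ℝ) * (⌊x⌋₊ + 1) / (2 * x)))
      * beta (⌊x⌋₊ + x / 2 + 1) ((ν : ℝ) - ⌊x⌋₊)
      * ((x / 2) ^ (ν - ⌊x⌋₊) / ((ν - ⌊x⌋₊ - 1)! : ℝ))
    / (1 + 2 * upperH 0 x)

/-- Upper bound for `e^{-x} I_ν(x)` in the range `ν > x` (where `ν - [x] ≥ 1`). -/
def betaUpper (ν : ℕ) (x : ℝ) : ℝ :=
  Real.exp (-(alphaZero * (⌊x⌋₊ : ℝ) ^ 2 / (2 * x)))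
      * beta (⌊x⌋₊ + x + 1 / 2) ((ν : ℝ) - ⌊x⌋₊)
      * (x ^ (ν - ⌊x⌋₊) / ((ν - ⌊x⌋₊ - 1)! : ℝ))
    / (1 + 2 * lowerH 0 x)

/-- The Skellam distribution: the law of `X₁ - X₂` for independent Poisson variables
`X₁`, `X₂` with parameters `a`, `b`. -/
def skellamMeasure (a b : ℝ≥0) : Measure ℤ :=
  ((poissonMeasure a).prod (poissonMeasure b)).map (fun p : ℕ × ℕ => (p.1 : ℤ) - (p.2 : ℤ))

/-- The factor relating `e^{-x} I_ν(x)` at `x = 2√(ab)` to the Skellam mass at `ν`. -/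
def skellamFactor (a b : ℝ≥0) (ν : ℕ) : ℝ :=
  √((a : ℝ) / b) ^ ν * Real.exp (-(√(a : ℝ) - √(b : ℝ)) ^ 2)

end

/-!
Write `r_k = I_k(x) / I_{k-1}(x)`, so that `I_ν = I_0 r_1 ⋯ r_ν`. The proof has two ingredients.

*Ratios.* The Cauchy product of two Bessel series is summed by Vandermonde's identity, and comparing
coefficients gives the bounds `amosF k x ≤ r_k ≤ amosF (k - 1 / 2) x` (`amosF_mul_le_besselI`,
`besselI_le_amosF_mul`). Since `amosF k x = exp (-arsinh (k / x))`, and `arsinh` lies on `[0, 1]`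
between its chord, of slope `alphaZero = arsinh 1`, and its tangent at `0`, the products of these
bounds are Gaussian for `ν ≤ x`. Beyond `x` the bounds `(x / 2) / (k + x / 2) ≤ amosF k x` and
`amosF k x ≤ x / (k + x)` multiply up to quotients of Gamma values, that is, to Beta values.

*Normalization.* The Skellam mass at `n` with parameters `a`, `b` is
`skellamFactor a b n * exp (-x) * I_n(x)` with `x = 2 √(ab)`. For `a = b = x / 2` the total mass one
reads `e ^ x = I_0 + 2 ∑_{k ≥ 1} I_k` (`hasSum_besselI_succ`), so that
`e ^ (-x) I_0 = 1 / (1 + 2 H)` with `H = ∑_{k ≥ 1} I_k / I_0`, and it remains to show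
`lowerH 0 x ≤ H ≤ upperH 0 x`.

For the upper bound, the terms below `⌊x⌋` are compared with a Gaussian integral and the others with
a geometric series. The lower bound needs care, as `lowerH` counts the term of index `⌊x⌋` both in
its Gaussian part and in its last summand. This is made up for by the weakness of the Gaussian tail
bound `exp (-a ^ 2 / (2 x)) * millsRoot a x`: it is bounded by the sum over the indices below `⌊x⌋`
alone, by a telescoping argument that uses only the quadratic equation of `millsRoot`
(`millsRoot_le_one_add`), up to an error in the last step that the subtracted Gaussian tail absorbs
(`millsRoot_last_le`).
-/

/-! ### Products of Bessel series and the Amos bounds -/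

theorem besselI_natCast (n : ℕ) (x : ℝ) :
    besselI n x = ∑' k : ℕ, (x / 2) ^ (2 * k + n) / ((k ! : ℝ) * ((n + k)! : ℝ)) := by
  unfold besselI
  refine tsum_congr fun k => ?_
  have h1 : Real.Gamma (k + n + 1) = ((n + k)! : ℝ) := by
    rw [← Real.Gamma_nat_eq_factorial]; push_cast; ring_nf
  have h2 : (2 * (k : ℝ) + n) = ((2 * k + n : ℕ) : ℝ) := by push_cast; ring
  rw [h1, h2, Real.rpow_natCast]; ring

theorem summable_bessel_terms (n : ℕ) {y : ℝ} (hy : 0 ≤ y) :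
    Summable fun k : ℕ => y ^ (2 * k + n) / ((k ! : ℝ) * ((n + k)! : ℝ)) := by
  refine Summable.of_nonneg_of_le (fun k => by positivity) (fun k => ?_)
    ((Real.summable_pow_div_factorial (y ^ 2)).mul_left (y ^ n))
  have h1 : (1 : ℝ) ≤ ((n + k)! : ℝ) := by exact_mod_cast Nat.factorial_pos _
  have h2 : (0 : ℝ) < (k ! : ℝ) := by exact_mod_cast Nat.factorial_pos _
  rw [pow_add, pow_mul, mul_comm (y ^ n), div_mul_eq_mul_div]
  exact div_le_div_of_nonneg_left (by positivity) h2 (le_mul_of_one_le_right h2.le h1)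

theorem besselI_pos (n : ℕ) {x : ℝ} (hx : 0 < x) : 0 < besselI n x := by
  rw [besselI_natCast]
  exact (summable_bessel_terms n (by positivity)).tsum_pos (fun k => by positivity) 0 (by positivity)

/-- The coefficients of the Cauchy product of two Bessel series, summed by Vandermonde's identity. -/
theorem sum_antidiagonal_inv_factorials (m n k : ℕ) :
    ∑ p ∈ Finset.HasAntidiagonal.antidiagonal k,
        1 / ((p.1 ! : ℝ) * ((m + p.1)! : ℝ)) * (1 / ((p.2 ! : ℝ) * ((n + p.2)! : ℝ)))
      = ((m + n + 2 * k)! : ℝ)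
          / ((k ! : ℝ) * ((m + k)! : ℝ) * ((n + k)! : ℝ) * ((m + n + k)! : ℝ)) := by
  have hV := Nat.add_choose_eq (n + k) (m + k) k
  have hc : ((n + k + (m + k)).choose k : ℝ) = ((m + n + 2 * k)! : ℝ)
      / ((k ! : ℝ) * ((m + n + k)! : ℝ)) := by
    rw [Nat.cast_choose ℝ (show k ≤ n + k + (m + k) by omega)]
    rw [show n + k + (m + k) - k = m + n + k by omega, show n + k + (m + k) = m + n + 2 * k by ring]
  have hs : ((n + k + (m + k)).choose k : ℝ) = ((m + k)! : ℝ) * ((n + k)! : ℝ) *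
      ∑ p ∈ Finset.HasAntidiagonal.antidiagonal k,
        1 / ((p.1 ! : ℝ) * ((m + p.1)! : ℝ)) * (1 / ((p.2 ! : ℝ) * ((n + p.2)! : ℝ))) := by
    rw [hV, Finset.mul_sum]
    push_cast
    refine Finset.sum_congr rfl fun p hp => ?_
    have hp' : p.1 + p.2 = k := by simpa using hp
    rw [Nat.cast_choose ℝ (show p.1 ≤ n + k by omega),
      Nat.cast_choose ℝ (show p.2 ≤ m + k by omega)]
    have e1 : n + k - p.1 = n + p.2 := by omega
    have e2 : m + k - p.2 = m + p.1 := by omega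
    rw [e1, e2]
    field_simp
  rw [hc] at hs
  have h1 : ((m + k)! : ℝ) ≠ 0 := by positivity
  have h2 : ((n + k)! : ℝ) ≠ 0 := by positivity
  have h3 : ((m + n + k)! : ℝ) ≠ 0 := by positivity
  have h4 : (k ! : ℝ) ≠ 0 := by positivity
  rw [div_eq_iff (by positivity)] at hs
  rw [eq_div_iff (by positivity), hs]
  ring

theorem hasSum_besselI_mul (m n : ℕ) {x : ℝ} (hx : 0 ≤ x) :
    HasSum (fun k : ℕ => ((m + n + 2 * k)! : ℝ)
          / ((k ! : ℝ) * ((m + k)! : ℝ) * ((n + k)! : ℝ) * ((m + n + k)! : ℝ))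
          * (x / 2) ^ (2 * k + (m + n)))
      (besselI m x * besselI n x) := by
  have hy : 0 ≤ x / 2 := by positivity
  have hm := summable_bessel_terms m hy
  have hn := summable_bessel_terms n hy
  have hmn := hm.norm
  have hnn := hn.norm
  have hS := (summable_norm_sum_mul_antidiagonal_of_summable_norm hmn hnn).of_norm
  have hT := tsum_mul_tsum_eq_tsum_sum_antidiagonal_of_summable_norm hmn hnn
  have h := hS.hasSum
  rw [← hT, ← besselI_natCast, ← besselI_natCast] at h
  convert! h using 2 with k
  rw [← sum_antidiagonal_inv_factorials, Finset.sum_mul]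
  refine Finset.sum_congr rfl fun p hp => ?_
  have hp' : p.1 + p.2 = k := by simpa using hp
  rw [← hp']
  have : 2 * (p.1 + p.2) + (m + n) = (2 * p.1 + m) + (2 * p.2 + n) := by ring
  rw [this, pow_add _ (2 * p.1 + m)]
  ring

/-- The quadratic form `I_{m+1} ^ 2 + (2 p / x) I_{m+1} I_m - I_m ^ 2` as a power series. Since
`amosF p x` is the positive root of `r ^ 2 + (2 p / x) r = 1`, the sign of this form tells on which
side of `amosF p x` the ratio `I_{m+1} / I_m` lies; all coefficients are nonnegative for `p = m + 1`
and nonpositive for `p = m + 1 / 2`. -/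
theorem hasSum_besselI_quadratic (m : ℕ) (p : ℝ) {x : ℝ} (hx : 0 < x) :
    HasSum (fun k : ℕ => ((2 * m + 2 * k)! : ℝ)
          / ((k ! : ℝ) * ((m + k)! : ℝ) * ((m + 1 + k)! : ℝ) * ((2 * m + 1 + k)! : ℝ))
          * (x / 2) ^ (2 * k + 2 * m)
          * (p * (2 * m + 1 + 2 * k) - (2 * m + 1) * (m + 1 + k)))
      (besselI (m + 1 : ℕ) x ^ 2 + 2 * p / x * (besselI (m + 1 : ℕ) x * besselI m x)
        - besselI m x ^ 2) := by
  have h0 := hasSum_besselI_mul m m hx.le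
  have h1 := (hasSum_besselI_mul (m + 1) m hx.le).mul_left (2 * p / x)
  have h2 := hasSum_besselI_mul (m + 1) (m + 1) hx.le
  -- the series of `I_{m+1} ^ 2` starts two powers later; shift it by adding a zero term
  have h2' : HasSum (fun k : ℕ => ((2 * m + 2 * k)! : ℝ)
          / ((k ! : ℝ) * ((m + k)! : ℝ) * ((m + 1 + k)! : ℝ) * ((2 * m + 1 + k)! : ℝ))
          * (x / 2) ^ (2 * k + 2 * m) * (k * (m + 1 + k)))
      (besselI (m + 1 : ℕ) x * besselI (m + 1 : ℕ) x) := by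
    rw [← hasSum_nat_add_iff' 1]
    simp only [Finset.range_one, Finset.sum_singleton, Nat.cast_zero, zero_mul, mul_zero, sub_zero]
    convert! h2 using 2 with k
    have e1 : 2 * m + 2 * (k + 1) = m + 1 + (m + 1) + 2 * k := by ring
    have e2 : 2 * (k + 1) + 2 * m = 2 * k + (m + 1 + (m + 1)) := by ring
    have e3 : m + (k + 1) = m + 1 + k := by ring
    have e4 : m + 1 + (k + 1) = (m + 1 + k) + 1 := by ring
    have e5 : 2 * m + 1 + (k + 1) = m + 1 + (m + 1) + k := by ring
    rw [e1, e2, e3, e4, e5, Nat.factorial_succ k, Nat.factorial_succ (m + 1 + k)]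
    push_cast
    field_simp
    ring
  convert! (h2'.add h1).sub h0 using 1
  · funext k
    have e0 : m + m + 2 * k = 2 * m + 2 * k := by ring
    have e1 : m + 1 + m + 2 * k = (2 * m + 2 * k) + 1 := by ring
    have e2 : m + 1 + m + k = 2 * m + 1 + k := by ring
    have e3 : 2 * k + (m + m) = 2 * k + 2 * m := by ring
    have e4 : 2 * k + (m + 1 + m) = (2 * k + 2 * m) + 1 := by ring
    have e5 : (2 * m + 1 + k)! = (2 * m + 1 + k) * (m + m + k)! := by
      rw [show 2 * m + 1 + k = (m + m + k) + 1 by ring, Nat.factorial_succ]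
    have e6 : (m + 1 + k)! = (m + 1 + k) * (m + k)! := by
      rw [show m + 1 + k = (m + k) + 1 by ring, Nat.factorial_succ]
    rw [e0, e1, e2, e3, e4, Nat.factorial_succ, e5, e6, pow_succ]
    push_cast
    field_simp
    ring
  · ring

theorem amosF_pos {ν x : ℝ} (hν : 0 ≤ ν) (hx : 0 < x) : 0 < amosF ν x := by
  unfold amosF; positivity

theorem amosF_quadratic {ν x : ℝ} (hν : 0 ≤ ν) (hx : 0 < x) :
    amosF ν x ^ 2 + 2 * ν / x * amosF ν x = 1 := by
  unfold amosF
  have h := Real.sq_sqrt (show 0 ≤ ν ^ 2 + x ^ 2 by positivity)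
  have hD : 0 < ν + √(ν ^ 2 + x ^ 2) := by positivity
  field_simp
  nlinarith

theorem amosF_mul_le_besselI (m : ℕ) {x : ℝ} (hx : 0 < x) :
    amosF (m + 1) x * besselI m x ≤ besselI (m + 1 : ℕ) x := by
  have hF := amosF_pos (ν := m + 1) (by positivity) hx
  have hq := amosF_quadratic (ν := m + 1) (by positivity) hx
  have h0 := besselI_pos m hx
  have h1 := besselI_pos (m + 1) hx
  have hS := (hasSum_besselI_quadratic m (m + 1) hx).nonneg fun k => by
    refine mul_nonneg (by positivity) ?_
    have : (0 : ℝ) ≤ k := by positivity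
    nlinarith
  by_contra! hlt
  have hp : 0 < 2 * ((m : ℝ) + 1) / x := by positivity
  have e1 : besselI (m + 1 : ℕ) x ^ 2 < (amosF (m + 1) x * besselI m x) ^ 2 :=
    pow_lt_pow_left₀ hlt h1.le (by norm_num)
  have e2 := mul_lt_mul_of_pos_left (mul_lt_mul_of_pos_right hlt h0) hp
  have e3 : (amosF (m + 1) x * besselI m x) ^ 2
      + 2 * ((m : ℝ) + 1) / x * (amosF (m + 1) x * besselI m x * besselI m x)
      = besselI m x ^ 2 := by linear_combination besselI m x ^ 2 * hq
  linarith

theorem besselI_le_amosF_mul (m : ℕ) {x : ℝ} (hx : 0 < x) :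
    besselI (m + 1 : ℕ) x ≤ amosF (m + 1 / 2) x * besselI m x := by
  have hF := amosF_pos (ν := m + 1 / 2) (by positivity) hx
  have hq := amosF_quadratic (ν := m + 1 / 2) (by positivity) hx
  have h0 := besselI_pos m hx
  have h1 := besselI_pos (m + 1) hx
  have hS := (hasSum_besselI_quadratic m (m + 1 / 2) hx).nonpos fun k => by
    refine mul_nonpos_of_nonneg_of_nonpos (by positivity) ?_
    have : (0 : ℝ) ≤ k := by positivity
    have : (0 : ℝ) ≤ m := by positivity
    nlinarith
  by_contra! hlt
  have hp : 0 < 2 * ((m : ℝ) + 1 / 2) / x := by positivity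
  have e1 : (amosF (m + 1 / 2) x * besselI m x) ^ 2 < besselI (m + 1 : ℕ) x ^ 2 :=
    pow_lt_pow_left₀ hlt (by positivity) (by norm_num)
  have e2 := mul_lt_mul_of_pos_left (mul_lt_mul_of_pos_right hlt h0) hp
  have e3 : (amosF (m + 1 / 2) x * besselI m x) ^ 2
      + 2 * ((m : ℝ) + 1 / 2) / x * (amosF (m + 1 / 2) x * besselI m x * besselI m x)
      = besselI m x ^ 2 := by linear_combination besselI m x ^ 2 * hq
  linarith

/-! ### Bounds for `I_n / I_0` -/

theorem amosF_eq_exp_neg_arsinh {x : ℝ} (ν : ℝ) (hx : 0 < x) :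
    amosF ν x = Real.exp (-Real.arsinh (ν / x)) := by
  have h : √(ν ^ 2 + x ^ 2) = x * √(1 + (ν / x) ^ 2) := by
    rw [← Real.sqrt_sq hx.le, ← Real.sqrt_mul (sq_nonneg x), Real.sqrt_sq hx.le]
    congr 1
    field_simp
    ring
  rw [Real.exp_neg, Real.exp_arsinh, amosF, h]
  rw [show ν + x * √(1 + (ν / x) ^ 2) = x * (ν / x + √(1 + (ν / x) ^ 2)) by field_simp]
  rw [div_mul_eq_div_div, div_self hx.ne', one_div]

theorem amosF_le_amosF {ν μ x : ℝ} (h : ν ≤ μ) (hx : 0 < x) : amosF μ x ≤ amosF ν x := by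
  rw [amosF_eq_exp_neg_arsinh _ hx, amosF_eq_exp_neg_arsinh _ hx, Real.exp_le_exp, neg_le_neg_iff,
    Real.arsinh_le_arsinh]
  gcongr

theorem amosF_lt_one {ν x : ℝ} (hν : 0 < ν) (hx : 0 < x) : amosF ν x < 1 := by
  rw [amosF_eq_exp_neg_arsinh _ hx, Real.exp_lt_one_iff, neg_lt_zero, Real.arsinh_pos_iff]
  positivity

/-- The tangent of `arsinh` at `0`. -/
theorem exp_neg_div_le_amosF {ν x : ℝ} (hν : 0 ≤ ν) (hx : 0 < x) :
    Real.exp (-(ν / x)) ≤ amosF ν x := by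
  rw [amosF_eq_exp_neg_arsinh _ hx, Real.exp_le_exp, neg_le_neg_iff, ← Real.sinh_le_sinh,
    Real.sinh_arsinh]
  exact Real.self_le_sinh_iff.2 (by positivity)

theorem sinh_alphaZero : Real.sinh alphaZero = 1 := by
  have h2 : (1 : ℝ) < √2 := by rw [Real.lt_sqrt] <;> norm_num
  have hs : √2 ^ 2 = 2 := Real.sq_sqrt (by norm_num)
  rw [Real.sinh_eq, alphaZero, neg_neg, Real.exp_neg, Real.exp_log (by linarith)]
  have : √2 - 1 ≠ 0 := by linarith
  field_simp
  nlinarith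

theorem alphaZero_pos : 0 < alphaZero := by
  rw [← Real.sinh_pos_iff, sinh_alphaZero]; norm_num

theorem alphaZero_gt : 0.85 < alphaZero := by
  have h2 : (1.414 : ℝ) < √2 := by rw [Real.lt_sqrt] <;> norm_num
  have hs : √2 ^ 2 = 2 := Real.sq_sqrt (by norm_num)
  have hinv : (√2 - 1)⁻¹ = √2 + 1 := by
    refine inv_eq_of_mul_eq_one_right ?_
    nlinarith
  rw [alphaZero, ← Real.log_inv, hinv, Real.lt_log_iff_exp_lt (by linarith)]
  have := Real.exp_bound' (x := 0.85) (by norm_num) (by norm_num) (n := 6) (by norm_num)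
  refine this.trans_lt ?_
  norm_num [Finset.sum_range_succ, Nat.factorial] at *
  linarith

theorem sinh_mul_le {t c : ℝ} (ht : 0 ≤ t) (ht1 : t ≤ 1) (hc : 0 ≤ c) :
    Real.sinh (c * t) ≤ t * Real.sinh c := by
  have hconv : ConvexOn ℝ (Set.Ici 0) Real.sinh := by
    refine MonotoneOn.convexOn_of_deriv (convex_Ici 0) Real.continuous_sinh.continuousOn
      Real.differentiable_sinh.differentiableOn ?_
    rw [Real.deriv_sinh, interior_Ici]
    intro a ha b hb hab
    rw [Real.cosh_le_cosh, abs_of_pos ha, abs_of_pos hb]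
    exact hab
  have := hconv.2 (Set.self_mem_Ici (a := 0)) (Set.mem_Ici.2 hc) (sub_nonneg.2 ht1) ht
    (sub_add_cancel 1 t)
  simpa [mul_comm] using this

/-- The chord of `arsinh` between `0` and `1` has slope `arsinh 1 = alphaZero`. -/
theorem amosF_le_exp_neg {ν x : ℝ} (hν : 0 ≤ ν) (hx : 0 < x) (hνx : ν ≤ x) :
    amosF ν x ≤ Real.exp (-(alphaZero * ν / x)) := by
  rw [amosF_eq_exp_neg_arsinh _ hx, Real.exp_le_exp, neg_le_neg_iff, ← Real.sinh_le_sinh,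
    Real.sinh_arsinh, mul_div_assoc]
  simpa [sinh_alphaZero] using
    sinh_mul_le (t := ν / x) (by positivity) (by rwa [div_le_one hx]) alphaZero_pos.le

theorem exp_mul_besselI_zero_le (n : ℕ) {x : ℝ} (hx : 0 < x) :
    Real.exp (-((n : ℝ) * (n + 1) / (2 * x))) * besselI (0 : ℕ) x ≤ besselI n x := by
  induction n with
  | zero => simp
  | succ n ih =>
    refine le_trans ?_ (amosF_mul_le_besselI n hx)
    have h := exp_neg_div_le_amosF (ν := n + 1) (by positivity) hx
    calc _ = Real.exp (-(((n : ℝ) + 1) / x))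
          * (Real.exp (-((n : ℝ) * (n + 1) / (2 * x))) * besselI (0 : ℕ) x) := by
            rw [← mul_assoc, ← Real.exp_add]
            congr 2
            push_cast
            field_simp
            ring
      _ ≤ _ := by
        have := besselI_pos 0 hx
        have := amosF_pos (ν := n + 1) (by positivity) hx
        gcongr

theorem besselI_le_exp_mul (n : ℕ) {x : ℝ} (hx : 0 < x) (hn : (n : ℝ) ≤ x) :
    besselI n x ≤ Real.exp (-(alphaZero * (n : ℝ) ^ 2 / (2 * x))) * besselI (0 : ℕ) x := by
  induction n with
  | zero => simp
  | succ n ih =>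
    push_cast at hn
    refine (besselI_le_amosF_mul n hx).trans ?_
    have h := amosF_le_exp_neg (ν := n + 1 / 2) (by positivity) hx (by linarith)
    have h0 := besselI_pos n hx
    calc _ ≤ Real.exp (-(alphaZero * (n + 1 / 2) / x))
          * (Real.exp (-(alphaZero * (n : ℝ) ^ 2 / (2 * x))) * besselI (0 : ℕ) x) := by
            have := ih (by linarith)
            gcongr
      _ = _ := by
            rw [← mul_assoc, ← Real.exp_add]
            congr 2
            push_cast
            field_simp
            ring

theorem div_le_amosF {ν x : ℝ} (hν : 0 ≤ ν) (hx : 0 < x) : x / 2 / (ν + x / 2) ≤ amosF ν x := by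
  have h : √(ν ^ 2 + x ^ 2) ≤ ν + x := by
    rw [Real.sqrt_le_left (by positivity)]; nlinarith
  have : 0 ≤ √(ν ^ 2 + x ^ 2) := Real.sqrt_nonneg _
  rw [amosF, div_le_div_iff₀ (by positivity) (by positivity)]
  nlinarith

theorem amosF_le_div {ν x : ℝ} (hν : 0 ≤ ν) (hx : 0 < x) : amosF ν x ≤ x / (ν + x) := by
  have h : x ≤ √(ν ^ 2 + x ^ 2) := by
    rw [Real.le_sqrt' hx]; nlinarith
  rw [amosF]
  gcongr

/-- The quotient of Gamma values is the inverse of the product of the denominators of the lower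
bounds `(x / 2) / (k + x / 2)` for the ratios `I_k / I_{k-1}`, `N < k ≤ N + d`. -/
theorem Gamma_div_mul_besselI_le (N d : ℕ) {x : ℝ} (hx : 0 < x) :
    Real.Gamma (N + x / 2 + 1) / Real.Gamma (N + x / 2 + 1 + d) * (x / 2) ^ d * besselI N x
      ≤ besselI (N + d : ℕ) x := by
  have hc : 0 < (N : ℝ) + x / 2 + 1 := by positivity
  induction d with
  | zero => simp [(Real.Gamma_pos_of_pos hc).ne']
  | succ d ih =>
    have hcd : 0 < (N : ℝ) + x / 2 + 1 + d := by positivity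
    refine le_trans ?_ (amosF_mul_le_besselI (N + d) hx)
    have h := div_le_amosF (ν := (N + d : ℕ) + 1) (by positivity) hx
    have hG := Real.Gamma_pos_of_pos hcd
    calc _ = x / 2 / (((N + d : ℕ) : ℝ) + 1 + x / 2)
          * (Real.Gamma (N + x / 2 + 1) / Real.Gamma (N + x / 2 + 1 + d) * (x / 2) ^ d
            * besselI N x) := by
            rw [Nat.cast_succ, ← add_assoc, Real.Gamma_add_one hcd.ne']
            push_cast
            rw [show (N : ℝ) + d + 1 + x / 2 = N + x / 2 + 1 + d by ring, pow_succ]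
            field_simp
      _ ≤ _ := by
        have := besselI_pos N hx
        have := Real.Gamma_pos_of_pos hc
        have := amosF_pos (ν := (N + d : ℕ) + 1) (by positivity) hx
        gcongr

theorem besselI_le_Gamma_div_mul (N d : ℕ) {x : ℝ} (hx : 0 < x) :
    besselI (N + d : ℕ) x ≤
      Real.Gamma (N + x + 1 / 2) / Real.Gamma (N + x + 1 / 2 + d) * x ^ d * besselI N x := by
  have hc : 0 < (N : ℝ) + x + 1 / 2 := by positivity
  induction d with
  | zero =>
    rw [Nat.cast_zero, add_zero ((N : ℝ) + x + 1 / 2), div_self (Real.Gamma_pos_of_pos hc).ne']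
    simp
  | succ d ih =>
    have hcd : 0 < (N : ℝ) + x + 1 / 2 + d := by positivity
    refine (besselI_le_amosF_mul (N + d) hx).trans ?_
    have h := amosF_le_div (ν := (N + d : ℕ) + 1 / 2) (by positivity) hx
    have hG := Real.Gamma_pos_of_pos hcd
    have := besselI_pos (N + d) hx
    calc _ ≤ x / (((N + d : ℕ) : ℝ) + 1 / 2 + x)
          * (Real.Gamma (N + x + 1 / 2) / Real.Gamma (N + x + 1 / 2 + d) * x ^ d
            * besselI N x) := by gcongr
      _ = _ := by
            rw [Nat.cast_succ, ← add_assoc, Real.Gamma_add_one hcd.ne']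
            push_cast
            rw [show (N : ℝ) + d + 1 / 2 + x = N + x + 1 / 2 + d by ring, pow_succ]
            field_simp

theorem beta_div_factorial (c : ℝ) {d : ℕ} (hd : 0 < d) :
    beta c d / ((d - 1)! : ℝ) = Real.Gamma c / Real.Gamma (c + d) := by
  obtain ⟨e, rfl⟩ := Nat.exists_eq_add_of_lt hd
  have h : Real.Gamma ((0 + e + 1 : ℕ) : ℝ) = (e ! : ℝ) := by
    rw [← Real.Gamma_nat_eq_factorial]; simp
  rw [beta, h]
  simp only [zero_add, add_tsub_cancel_right]
  have : (e ! : ℝ) ≠ 0 := by positivity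
  field_simp

/-! ### The Skellam distribution and the generating function -/

theorem poisson_prod_real_range (a b : ℝ≥0) {e : ℕ → ℕ × ℕ} (he : Function.Injective e) :
    ((poissonMeasure a).prod (poissonMeasure b)).real (Set.range e)
      = ∑' k, (poissonMeasure a).real {(e k).1} * (poissonMeasure b).real {(e k).2} := by
  have h : Set.range e = ⋃ k, {e k} := by ext; simp [eq_comm]
  rw [h, measureReal_def, measure_iUnion _ (fun _ => measurableSet_singleton _),
    ENNReal.tsum_toReal_eq (fun _ => measure_ne_top _ _)]
  · refine tsum_congr fun k => ?_
    rw [← Set.singleton_prod_singleton, Measure.prod_prod, ENNReal.toReal_mul]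
    rfl
  · intro i j hij
    simpa using fun h => hij (he h)

theorem skellamMeasure_real_natCast (a b : ℝ≥0) (n : ℕ) :
    (skellamMeasure a b).real {(n : ℤ)} = ∑' k : ℕ,
      (poissonMeasure a).real {n + k} * (poissonMeasure b).real {k} := by
  rw [skellamMeasure, map_measureReal_apply (by fun_prop) (measurableSet_singleton _)]
  rw [← poisson_prod_real_range a b (e := fun k => (n + k, k))
    (fun i j h => by simpa using congrArg Prod.snd h)]
  congr 1
  ext ⟨i, j⟩
  simp only [Set.mem_preimage, Set.mem_singleton_iff, Set.mem_range, Prod.mk.injEq]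
  constructor
  · intro h; exact ⟨j, by omega, rfl⟩
  · rintro ⟨k, rfl, rfl⟩; push_cast; ring

theorem skellamMeasure_real_neg_natCast (a b : ℝ≥0) (n : ℕ) :
    (skellamMeasure a b).real {-(n : ℤ)} = ∑' k : ℕ,
      (poissonMeasure a).real {k} * (poissonMeasure b).real {n + k} := by
  rw [skellamMeasure, map_measureReal_apply (by fun_prop) (measurableSet_singleton _)]
  rw [← poisson_prod_real_range a b (e := fun k => (k, n + k))
    (fun i j h => by simpa using congrArg Prod.fst h)]
  congr 1
  ext ⟨i, j⟩
  simp only [Set.mem_preimage, Set.mem_singleton_iff, Set.mem_range, Prod.mk.injEq]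
  constructor
  · intro h; exact ⟨i, rfl, by omega⟩
  · rintro ⟨k, rfl, rfl⟩; push_cast; ring

/-- The mass of the Skellam distribution at `n` in terms of `I_n`. -/
theorem skellamMeasure_real_eq (a b : ℝ≥0) (ha : 0 < a) (hb : 0 < b) (n : ℕ) :
    (skellamMeasure a b).real {(n : ℤ)} = skellamFactor a b n
      * (Real.exp (-(2 * √((a : ℝ) * b))) * besselI n (2 * √((a : ℝ) * b))) := by
  have ha' : (0 : ℝ) < a := ha
  have hb' : (0 : ℝ) < b := hb
  rw [skellamMeasure_real_natCast, besselI_natCast, skellamFactor, ← tsum_mul_left, ← tsum_mul_left]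
  refine tsum_congr fun k => ?_
  rw [poissonMeasure_real_singleton, poissonMeasure_real_singleton]
  obtain ⟨s, hs, hsa⟩ : ∃ s : ℝ, 0 < s ∧ (a : ℝ) = s ^ 2 :=
    ⟨√a, by positivity, (Real.sq_sqrt ha'.le).symm⟩
  obtain ⟨t, ht, htb⟩ : ∃ t : ℝ, 0 < t ∧ (b : ℝ) = t ^ 2 :=
    ⟨√b, by positivity, (Real.sq_sqrt hb'.le).symm⟩
  rw [hsa, htb, ← div_pow, ← mul_pow, Real.sqrt_sq hs.le, Real.sqrt_sq ht.le,
    Real.sqrt_sq (by positivity), Real.sqrt_sq (by positivity)]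
  have hE : Real.exp (-s ^ 2) * Real.exp (-t ^ 2)
      = Real.exp (-(s - t) ^ 2) * Real.exp (-(2 * (s * t))) := by
    rw [← Real.exp_add, ← Real.exp_add]; ring_nf
  rw [show 2 * (s * t) / 2 = s * t by ring]
  have e1 : (s ^ 2) ^ (n + k) * (t ^ 2) ^ k = (s / t) ^ n * (s * t) ^ (2 * k + n) := by
    rw [div_pow, mul_pow]
    field_simp
    ring
  calc _ = Real.exp (-s ^ 2) * Real.exp (-t ^ 2) * ((s ^ 2) ^ (n + k) * (t ^ 2) ^ k)
        / ((k ! : ℝ) * ((n + k)! : ℝ)) := by ring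
    _ = _ := by rw [hE, e1]; ring

instance (a b : ℝ≥0) : IsProbabilityMeasure (skellamMeasure a b) :=
  Measure.isProbabilityMeasure_map (by fun_prop)

/-- The generating function identity `e ^ x = I_0(x) + 2 ∑_{k ≥ 1} I_k(x)`: it says that the
Skellam distribution with both parameters equal to `x / 2` has total mass one. -/
theorem hasSum_besselI_succ {x : ℝ} (hx : 0 < x) :
    HasSum (fun k : ℕ => besselI (k + 1 : ℕ) x) ((Real.exp x - besselI (0 : ℕ) x) / 2) := by
  set a : ℝ≥0 := ⟨x / 2, by positivity⟩ with ha
  have hav : (a : ℝ) = x / 2 := rfl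
  have ha0 : 0 < a := by rw [← NNReal.coe_pos, hav]; positivity
  have hmass (n : ℕ) : (skellamMeasure a a).real {(n : ℤ)} = Real.exp (-x) * besselI n x := by
    rw [skellamMeasure_real_eq a a ha0 ha0, skellamFactor]
    have h1 : 2 * √((a : ℝ) * a) = x := by
      rw [hav, Real.sqrt_mul_self (by positivity)]; ring
    have h2 : (a : ℝ) / a = 1 := div_self (NNReal.coe_pos.2 ha0).ne'
    rw [h1, h2]
    simp
  have hneg (n : ℕ) : (skellamMeasure a a).real {-(n : ℤ)} = Real.exp (-x) * besselI n x := by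
    rw [← hmass, skellamMeasure_real_neg_natCast, skellamMeasure_real_natCast]
    exact tsum_congr fun k => mul_comm _ _
  have htot : HasSum (fun n : ℤ => (skellamMeasure a a).real {n}) 1 := by
    have h := (skellamMeasure a a).tsum_indicator_apply_singleton Set.univ MeasurableSet.univ
    simp only [Set.indicator_univ, measure_univ] at h
    have hs : Summable fun n : ℤ => (skellamMeasure a a).real {n} :=
      ENNReal.summable_toReal (by rw [h]; simp)
    have h' := congrArg ENNReal.toReal h
    rw [ENNReal.tsum_toReal_eq (fun _ => measure_ne_top _ _)] at h'
    have h3 := hs.hasSum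
    simp only [measureReal_def] at h3 ⊢
    rw [h'] at h3
    simpa using h3
  have hS : Summable fun k : ℕ => Real.exp (-x) * besselI (k + 1 : ℕ) x := by
    have h := htot.summable.comp_injective (i := fun k : ℕ => ((k + 1 : ℕ) : ℤ))
      (fun i j h => by simpa using h)
    exact h.congr fun k => hmass (k + 1)
  have hS' : HasSum (fun n : ℤ => (skellamMeasure a a).real {n})
      ((∑' k : ℕ, Real.exp (-x) * besselI (k + 1 : ℕ) x) + (skellamMeasure a a).real {0}
        + ∑' k : ℕ, Real.exp (-x) * besselI (k + 1 : ℕ) x) := by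
    refine HasSum.of_add_one_of_neg_add_one ?_ ?_
    · refine hS.hasSum.congr_fun fun k => ?_
      exact_mod_cast hmass (k + 1)
    · refine hS.hasSum.congr_fun fun k => ?_
      exact_mod_cast hneg (k + 1)
  have hE : Real.exp x * Real.exp (-x) = 1 := by rw [← Real.exp_add]; simp
  have h1 := hS'.unique htot
  have h00 := hmass 0
  rw [Nat.cast_zero] at h00
  rw [h00] at h1
  have hS2 := hS.hasSum.mul_left (Real.exp x)
  simp only [← mul_assoc, hE, one_mul] at hS2
  convert! hS2 using 1
  have : Real.exp x * 1 = Real.exp x * _ := congrArg (Real.exp x * ·) h1.symm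
  linear_combination this / 2 + besselI (0 : ℕ) x / 2 * hE

/-! ### The upper bound for `H(0, x)` -/

/-- The ratio `H(0, x) = ∑_{k ≥ 1} I_k(x) / I_0(x)`, in the closed form given by the generating
function identity. -/
noncomputable def besselRatioSum (x : ℝ) : ℝ := (Real.exp x / besselI (0 : ℕ) x - 1) / 2

theorem hasSum_besselRatio {x : ℝ} (hx : 0 < x) :
    HasSum (fun k : ℕ => besselI (k + 1 : ℕ) x / besselI (0 : ℕ) x) (besselRatioSum x) := by
  have h0 := (besselI_pos 0 hx).ne'
  convert! (hasSum_besselI_succ hx).div_const (besselI (0 : ℕ) x) using 1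
  rw [besselRatioSum]
  field_simp

theorem exp_neg_mul_besselI_zero {x : ℝ} (hx : 0 < x) :
    Real.exp (-x) * besselI (0 : ℕ) x = 1 / (1 + 2 * besselRatioSum x) := by
  have h0 := (besselI_pos 0 hx).ne'
  rw [besselRatioSum, Real.exp_neg]
  field_simp
  ring

/-- From index `N + 1` on, the terms decay at least geometrically, because the upper bounds
`amosF (k - 1 / 2) x` of the ratios `I_k / I_{k-1}` decrease in `k`. -/
theorem tsum_besselI_tail_le (N : ℕ) {x : ℝ} (hx : 0 < x) :
    ∑' j : ℕ, besselI (j + N + 1 : ℕ) x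
      ≤ besselI N x * (amosF (N + 1 / 2) x / (1 - amosF (N + 3 / 2) x)) := by
  have hF := amosF_pos (ν := N + 1 / 2) (by positivity) hx
  have hq := amosF_pos (ν := N + 3 / 2) (by positivity) hx
  have hq1 := amosF_lt_one (ν := N + 3 / 2) (by positivity) hx
  have hterm (j : ℕ) : besselI (j + N + 1 : ℕ) x
      ≤ besselI N x * amosF (N + 1 / 2) x * amosF (N + 3 / 2) x ^ j := by
    induction j with
    | zero => simpa [mul_comm] using besselI_le_amosF_mul N hx
    | succ j ih =>
      have h1 := besselI_le_amosF_mul (j + N + 1) hx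
      have h2 : amosF ((j + N + 1 : ℕ) + 1 / 2) x ≤ amosF (N + 3 / 2) x :=
        amosF_le_amosF (by push_cast; have : (0 : ℝ) ≤ j := by positivity
                           linarith) hx
      have h0 := besselI_pos (j + N + 1) hx
      calc besselI (j + 1 + N + 1 : ℕ) x = besselI (j + N + 1 + 1 : ℕ) x := by
            rw [show j + 1 + N + 1 = j + N + 1 + 1 by ring]
        _ ≤ amosF (N + 3 / 2) x * besselI (j + N + 1 : ℕ) x := h1.trans (by gcongr)
        _ ≤ amosF (N + 3 / 2) x *
            (besselI N x * amosF (N + 1 / 2) x * amosF (N + 3 / 2) x ^ j) := by gcongr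
        _ = _ := by ring
  have hg := (hasSum_geometric_of_lt_one hq.le hq1).mul_left (besselI N x * amosF (N + 1 / 2) x)
  have hs : Summable fun j : ℕ => besselI (j + N + 1 : ℕ) x :=
    Summable.of_nonneg_of_le (fun j => (besselI_pos _ hx).le) hterm hg.summable
  calc _ ≤ _ := hs.tsum_le_of_sum_le fun s =>
        (Finset.sum_le_sum fun j _ => hterm j).trans
          (sum_le_hasSum s (fun j _ => by have := besselI_pos N hx; positivity) hg)
    _ = _ := by rw [div_eq_mul_inv]; ring

theorem besselRatioSum_le_sum_add (N : ℕ) {x : ℝ} (hx : 0 < x) (hN : (N : ℝ) ≤ x) :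
    besselRatioSum x ≤ ∑ k ∈ Finset.range N,
          Real.exp (-(alphaZero / (2 * x)) * ((k + 1 : ℕ) : ℝ) ^ 2)
      + Real.exp (-(alphaZero / (2 * x)) * (N : ℝ) ^ 2)
        * (amosF (N + 1 / 2) x / (1 - amosF (N + 3 / 2) x)) := by
  have h0 := besselI_pos 0 hx
  have hA (n : ℕ) (hn : (n : ℝ) ≤ x) : besselI n x / besselI (0 : ℕ) x
      ≤ Real.exp (-(alphaZero / (2 * x)) * (n : ℝ) ^ 2) := by
    rw [div_le_iff₀ h0]
    convert! besselI_le_exp_mul n hx hn using 3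
    ring
  have hH := hasSum_besselRatio hx
  rw [← hH.tsum_eq, ← hH.summable.sum_add_tsum_nat_add N]
  refine add_le_add (Finset.sum_le_sum fun k hk => hA _ ?_) ?_
  · have hk' : k + 1 ≤ N := Finset.mem_range.1 hk
    exact le_trans (by exact_mod_cast hk') hN
  · rw [tsum_div_const]
    have hq1 := amosF_lt_one (ν := N + 3 / 2) (by positivity) hx
    have hF := amosF_pos (ν := N + 1 / 2) (by positivity) hx
    calc _ ≤ besselI N x * (amosF (N + 1 / 2) x / (1 - amosF (N + 3 / 2) x))
          / besselI (0 : ℕ) x := by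
          have := tsum_besselI_tail_le N hx
          gcongr
      _ = besselI N x / besselI (0 : ℕ) x
          * (amosF (N + 1 / 2) x / (1 - amosF (N + 3 / 2) x)) := by ring
      _ ≤ _ := by
        have : 0 < 1 - amosF (N + 3 / 2) x := by linarith
        have := hA N hN
        gcongr

theorem mul_le_integral_of_antitoneOn {g : ℝ → ℝ} {a b : ℝ} (ha : 0 ≤ a) (hab : a ≤ b)
    (hg : AntitoneOn g (Set.Ici 0)) (hc : Continuous g) : (b - a) * g b ≤ ∫ t in a..b, g t := by
  have := intervalIntegral.integral_mono_on (f := fun _ => g b) (g := g) hab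
    (by simp) (hc.intervalIntegrable (μ := volume) a b)
    fun t ht => hg (ha.trans ht.1) (ha.trans hab) ht.2
  simpa using this

/-- The integral is compared with the sum on `[0, N]`, and on `[x - 1, x]` with the values at
`x - 1 / 2` and `x`. -/
theorem sum_exp_add_le_gaussian_integral (N : ℕ) {β x : ℝ} (hβ : 0 < β) (hx : (N : ℝ) + 1 ≤ x) :
    ∑ k ∈ Finset.range N, Real.exp (-β * ((k + 1 : ℕ) : ℝ) ^ 2)
      + (Real.exp (-β * (x - 1 / 2) ^ 2) + Real.exp (-β * x ^ 2)) / 2 ≤ √(Real.pi / β) / 2 := by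
  set g : ℝ → ℝ := fun t => Real.exp (-β * t ^ 2) with hgdef
  have hc : Continuous g := by fun_prop
  have hanti : AntitoneOn g (Set.Ici 0) := by
    intro s hs t _ hst
    have : s ^ 2 ≤ t ^ 2 := pow_le_pow_left₀ hs hst 2
    simp only [hgdef, Real.exp_le_exp]
    nlinarith
  have hN : (0 : ℝ) ≤ N := by positivity
  have h1 : ∑ k ∈ Finset.range N, g ((k + 1 : ℕ) : ℝ) ≤ ∫ t in (0 : ℝ)..N, g t := by
    simpa using AntitoneOn.sum_le_integral (x₀ := 0) (a := N) (f := g)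
      (hanti.mono fun t ht => ht.1)
  have h2 := mul_le_integral_of_antitoneOn hN (show (N : ℝ) ≤ x - 1 / 2 by linarith) hanti hc
  have h3 := mul_le_integral_of_antitoneOn (a := x - 1 / 2) (b := x) (by linarith) (by linarith)
    hanti hc
  have hint (a b : ℝ) : IntervalIntegrable g volume a b := hc.intervalIntegrable a b
  have h4 : ∫ t in (0 : ℝ)..x, g t ≤ ∫ t in Set.Ioi (0 : ℝ), g t := by
    rw [intervalIntegral.integral_of_le (by linarith)]
    exact setIntegral_mono_set (integrable_exp_neg_mul_sq hβ).integrableOn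
      (Filter.Eventually.of_forall fun t => (Real.exp_pos _).le)
      (Set.Ioc_subset_Ioi_self.eventuallyLE)
  rw [integral_gaussian_Ioi] at h4
  rw [← intervalIntegral.integral_add_adjacent_intervals (hint 0 N) (hint N x),
    ← intervalIntegral.integral_add_adjacent_intervals (hint N (x - 1 / 2)) (hint _ x)] at h4
  have h5 : 1 / 2 * g (x - 1 / 2) ≤ (x - 1 / 2 - N) * g (x - 1 / 2) :=
    mul_le_mul_of_nonneg_right (by linarith) (Real.exp_pos _).le
  have h6 : (x - (x - 1 / 2)) * g x = 1 / 2 * g x := by ring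
  change ∑ k ∈ Finset.range N, g ((k + 1 : ℕ) : ℝ) + (g (x - 1 / 2) + g x) / 2 ≤ _
  linarith

/-- The gap between the Gaussian integral and the sum exceeds the tail term subtracted in `upperH`.
This is where a numerical lower bound for `alphaZero` is needed. -/
theorem exp_div_alphaZero_le {x : ℝ} (hx : 2 ≤ x) :
    Real.exp (-(alphaZero / (2 * x)) * x ^ 2) / alphaZero
      ≤ (Real.exp (-(alphaZero / (2 * x)) * (x - 1 / 2) ^ 2)
        + Real.exp (-(alphaZero / (2 * x)) * x ^ 2)) / 2 := by
  have hα := alphaZero_gt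
  have hx0 : 0 < x := by linarith
  have h1 : Real.exp (-(alphaZero / (2 * x)) * (x - 1 / 2) ^ 2)
      = Real.exp (-(alphaZero / (2 * x)) * x ^ 2)
        * Real.exp (alphaZero * ((x - 1 / 4) / (2 * x))) := by
    rw [← Real.exp_add]
    congr 1
    field_simp
    ring
  have h2 := Real.add_one_le_exp (alphaZero * ((x - 1 / 4) / (2 * x)))
  have h3 : 7 / 16 ≤ (x - 1 / 4) / (2 * x) := by
    rw [div_le_div_iff₀ (by norm_num) (by positivity)]
    linarith
  have h4 : alphaZero * (7 / 16) ≤ alphaZero * ((x - 1 / 4) / (2 * x)) :=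
    mul_le_mul_of_nonneg_left h3 (by linarith)
  rw [h1, div_le_iff₀ (by linarith)]
  have hE := Real.exp_pos (-(alphaZero / (2 * x)) * x ^ 2)
  have h5 : 1 ≤ (Real.exp (alphaZero * ((x - 1 / 4) / (2 * x))) + 1) / 2 * alphaZero := by
    nlinarith
  nlinarith

theorem besselRatioSum_le_upperH {x : ℝ} (hx : 0 < x) : besselRatioSum x ≤ upperH 0 x := by
  have hα := alphaZero_pos
  rw [upperH]
  split_ifs with h
  · simp only [Int.floor_zero, zero_add] at h
    obtain ⟨N, hN⟩ : ∃ N : ℕ, ⌊x⌋ = N + 1 := ⟨(⌊x⌋ - 1).toNat, by omega⟩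
    have hfx := Int.floor_le x
    rw [hN] at hfx
    push_cast at hfx
    have hx2 : 2 ≤ x := by
      have : (2 : ℝ) ≤ (⌊x⌋ : ℝ) := by exact_mod_cast h
      linarith [Int.floor_le x]
    have hmain := besselRatioSum_le_sum_add N hx (by linarith)
    have hgauss := sum_exp_add_le_gaussian_integral N (β := alphaZero / (2 * x)) (by positivity) hfx
    have hedge := exp_div_alphaZero_le hx2
    have hfirst : √(Real.pi / (alphaZero / (2 * x))) / 2
        = 2 * x / alphaZero * (1 / √(8 * x / (Real.pi * alphaZero))) := by
      have hs : 0 < √(8 * x / (Real.pi * alphaZero)) := by positivity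
      rw [← mul_left_inj' hs.ne', mul_assoc, one_div, inv_mul_cancel₀ hs.ne', div_mul_eq_mul_div,
        ← Real.sqrt_mul (by positivity)]
      rw [show Real.pi / (alphaZero / (2 * x)) * (8 * x / (Real.pi * alphaZero))
        = (4 * x / alphaZero) ^ 2 by field_simp; ring, Real.sqrt_sq (by positivity)]
      ring
    have hsecond : 2 * x / alphaZero * (Real.exp (-(alphaZero / (2 * x)) * x ^ 2)
        / (x + √(x ^ 2 + 4 * x / alphaZero)))
        ≤ Real.exp (-(alphaZero / (2 * x)) * x ^ 2) / alphaZero := by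
      have hs : x ≤ √(x ^ 2 + 4 * x / alphaZero) := by
        rw [Real.le_sqrt' hx]
        have : 0 ≤ 4 * x / alphaZero := by positivity
        linarith
      calc _ ≤ 2 * x / alphaZero * (Real.exp (-(alphaZero / (2 * x)) * x ^ 2) / (x + x)) := by
            gcongr
        _ = _ := by field_simp; ring
    simp only [hN, Int.floor_zero, Int.fract_zero, Int.cast_zero]
    push_cast
    rw [show (0 : ℝ) + √((0 : ℝ) ^ 2 + 8 * x / (Real.pi * alphaZero))
      = √(8 * x / (Real.pi * alphaZero)) by simp]
    rw [show x ^ 2 - (0 : ℝ) ^ 2 = x ^ 2 by ring,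
      show ((N : ℝ) + 1 - 0 - 1) * (N + 1 + 0 + 0 - 1) = (N : ℝ) ^ 2 by ring,
      show (N : ℝ) + 1 + 0 - 1 / 2 = N + 1 / 2 by ring,
      show (N : ℝ) + 1 + 0 + 1 / 2 = N + 3 / 2 by ring, mul_sub]
    linarith
  · simpa using besselRatioSum_le_sum_add 0 hx (by simpa using hx.le)

/-! ### The lower bound for `H(0, x)` -/

/-- The positive root of `q ^ 2 + a * q = x`. Up to the factor `exp (-a ^ 2 / (2 * x))` it is the
classical lower bound for the Gaussian tail integral from `a`. -/
noncomputable def millsRoot (a x : ℝ) : ℝ := 2 * x / (a + √(a ^ 2 + 4 * x))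

theorem millsRoot_pos {a x : ℝ} (ha : 0 ≤ a) (hx : 0 < x) : 0 < millsRoot a x := by
  unfold millsRoot; positivity

theorem millsRoot_quadratic {a x : ℝ} (ha : 0 ≤ a) (hx : 0 < x) :
    millsRoot a x ^ 2 + a * millsRoot a x = x := by
  unfold millsRoot
  have h := Real.sq_sqrt (show 0 ≤ a ^ 2 + 4 * x by positivity)
  have hD : 0 < a + √(a ^ 2 + 4 * x) := by positivity
  set s := √(a ^ 2 + 4 * x)
  field_simp
  nlinarith

theorem millsRoot_le_of_le_quadratic {a x y : ℝ} (ha : 0 ≤ a) (hx : 0 < x) (hy : 0 ≤ y)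
    (h : x ≤ y ^ 2 + a * y) : millsRoot a x ≤ y := by
  have h1 := millsRoot_quadratic ha hx
  by_contra! hlt
  nlinarith

/-- Multiplied by `exp (-n * (n + 1) / (2 * x))` for `A = n + 1`, this bounds the difference of two
consecutive Gaussian tail bounds by the Gaussian term of index `n`. -/
theorem millsRoot_le_one_add {A x : ℝ} (hA : 1 / 2 ≤ A) (hx : A ≤ x) :
    millsRoot (A - 1 / 2) x ≤ 1 + millsRoot (A + 1 / 2) x * Real.exp (-(A / x)) := by
  have hx0 : 0 < x := by linarith
  set q := millsRoot (A + 1 / 2) x with hqdef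
  have hq0 : 0 < q := millsRoot_pos (by linarith) hx0
  have hq : q ^ 2 + (A + 1 / 2) * q = x := millsRoot_quadratic (by linarith) hx0
  have hle : 1 + q * (1 - A / x) ≤ 1 + q * Real.exp (-(A / x)) := by
    have := Real.add_one_le_exp (-(A / x))
    gcongr
    linarith
  -- replacing `exp` by its tangent leaves an algebraic claim, settled by the equation of `q`
  refine le_trans ?_ hle
  have hAx : A / x ≤ 1 := by rw [div_le_one hx0]; linarith
  refine millsRoot_le_of_le_quadratic (by linarith) hx0
    (by have : 0 ≤ 1 - A / x := by linarith
        positivity) ?_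
  have hqe : q * (A / x) = A / (q + A + 1 / 2) := by
    rw [← hq]
    have : 0 < q ^ 2 + (A + 1 / 2) * q := by positivity
    field_simp
    ring
  set e := A / (q + A + 1 / 2) with hedef
  have hD : 0 < q + A + 1 / 2 := by linarith
  have he : e * (q + A + 1 / 2) = A := by rw [hedef]; field_simp
  rw [show 1 + q * (1 - A / x) = 1 + q - e by rw [← hqe]; ring]
  have hpD : ((1 + q - e) ^ 2 + (A - 1 / 2) * (1 + q - e) - x) * (q + A + 1 / 2)
      = (q + 1 / 2) ^ 2 - A / 2 + e * A := by
    linear_combination (q + A + 1 / 2) * hq + (e - (2 + 2 * q + (A - 1 / 2))) * he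
  have key : 0 ≤ ((1 + q - e) ^ 2 + (A - 1 / 2) * (1 + q - e) - x) * (q + A + 1 / 2) ^ 2 := by
    have : ((1 + q - e) ^ 2 + (A - 1 / 2) * (1 + q - e) - x) * (q + A + 1 / 2) ^ 2
        = (q + 1 / 2) ^ 3 + (q + 1 / 2) * q * A + A ^ 2 / 2 := by
      linear_combination (q + A + 1 / 2) * hpD + A * he
    rw [this]
    positivity
  have := nonneg_of_mul_nonneg_left key (by positivity)
  linarith

/-- The bound `millsRoot_le_one_add`, telescoped over `A = 2, …, K + 1`. -/
theorem exp_mul_millsRoot_le_sum (K : ℕ) {x : ℝ} (hx : (K : ℝ) + 1 ≤ x) :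
    Real.exp (-((1 : ℝ) * (1 + 1) / (2 * x))) * millsRoot (3 / 2) x
      ≤ ∑ k ∈ Finset.range K,
          Real.exp (-(((k + 1 : ℕ) : ℝ) * (((k + 1 : ℕ) : ℝ) + 1) / (2 * x)))
        + Real.exp (-(((K + 1 : ℕ) : ℝ) * (((K + 1 : ℕ) : ℝ) + 1) / (2 * x)))
          * millsRoot (K + 3 / 2) x := by
  induction K with
  | zero => simp
  | succ K ih =>
    push_cast at hx
    have hK : (0 : ℝ) ≤ K := by positivity
    have hx0 : 0 < x := by linarith
    refine (ih (by linarith)).trans ?_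
    rw [Finset.sum_range_succ, add_assoc]
    gcongr
    have h := millsRoot_le_one_add (A := K + 2) (x := x) (by linarith) (by linarith)
    rw [show (K : ℝ) + 2 - 1 / 2 = K + 3 / 2 by ring,
      show (K : ℝ) + 2 + 1 / 2 = (K + 1 : ℕ) + 3 / 2 by push_cast; ring] at h
    have hE : Real.exp (-(((K + 1 + 1 : ℕ) : ℝ) * (((K + 1 + 1 : ℕ) : ℝ) + 1) / (2 * x)))
        = Real.exp (-(((K + 1 : ℕ) : ℝ) * (((K + 1 : ℕ) : ℝ) + 1) / (2 * x)))
          * Real.exp (-((K + 2) / x)) := by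
      rw [← Real.exp_add]
      congr 1
      push_cast
      field_simp
      ring
    rw [hE]
    calc _ ≤ _ := mul_le_mul_of_nonneg_left h (Real.exp_pos _).le
      _ = _ := by ring

theorem exp_neg_two_gt : 0.135 < Real.exp (-2) := by
  have h : Real.exp 2 = Real.exp 1 ^ 2 := by rw [← Real.exp_nat_mul]; norm_num
  have h1 := Real.exp_one_lt_d9
  have h0 := Real.exp_pos 1
  rw [Real.exp_neg, h, lt_inv_comm₀ (by norm_num) (by positivity)]
  calc _ < (2.7182818286 : ℝ) ^ 2 := pow_lt_pow_left₀ h1 h0.le (by norm_num)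
    _ < _ := by norm_num

/-- The last term of the telescoping bound. `millsRoot (N - 1 / 2) x` exceeds `1` only for
`x > N + 1 / 2`, by at most `1 / (2 * N + 3)`, and the subtracted Gaussian tail makes up for it;
for `N = 2` these estimates just fall short, and the product of three ratios is needed as well. -/
theorem millsRoot_last_le (N : ℕ) {x : ℝ} (hN : 2 ≤ N) (hx : (N : ℝ) ≤ x) (hx1 : x ≤ N + 1) :
    millsRoot (N - 1 / 2) x ≤ 1
      + Real.exp (-((2 * N + 1) / x))
        * (2 * x / (N + 3 / 2 + √((N + 3 / 2) ^ 2 + 8 * x / Real.pi)))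
      + amosF N x * (amosF (N + 1) x * amosF (N + 2) x) := by
  have hN2 : (2 : ℝ) ≤ N := by exact_mod_cast hN
  have hx0 : 0 < x := by linarith
  set q := millsRoot (N - 1 / 2) x with hqdef
  have hq0 : 0 < q := millsRoot_pos (by linarith) hx0
  have hq : q ^ 2 + (N - 1 / 2) * q = x := millsRoot_quadratic (by linarith) hx0
  have hF0 := amosF_pos (ν := N) (by positivity) hx0
  have hF1 := amosF_pos (ν := N + 1) (by positivity) hx0
  have hF2 := amosF_pos (ν := N + 2) (by positivity) hx0
  rcases le_or_gt q 1 with hle | hgt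
  · have : 0 < Real.exp (-((2 * N + 1) / x))
        * (2 * x / (N + 3 / 2 + √((N + 3 / 2) ^ 2 + 8 * x / Real.pi))) := by positivity
    have : 0 < amosF N x * (amosF (N + 1) x * amosF (N + 2) x) := by positivity
    linarith
  obtain ⟨u, hu⟩ : ∃ u, u = x - N - 1 / 2 := ⟨_, rfl⟩
  have hqu : (q - 1) * (q + N + 1 / 2) = u := by rw [hu]; linear_combination hq
  have hu0 : 0 < u := by rw [← hqu]; apply mul_pos <;> linarith
  have hxu : x = N + 1 / 2 + u := by linarith
  have hq1 : q - 1 ≤ u / (N + 3 / 2) := by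
    rw [le_div_iff₀ (by linarith)]
    nlinarith
  have hψ : x / (N + 2.14) ≤ 2 * x / (N + 3 / 2 + √((N + 3 / 2) ^ 2 + 8 * x / Real.pi)) := by
    have hpi := Real.pi_gt_d2
    have h8 : 8 * x / Real.pi ≤ 2.56 * x := by
      rw [div_le_iff₀ (by positivity)]
      nlinarith
    have hs : √((N + 3 / 2) ^ 2 + 8 * x / Real.pi) ≤ N + 3 / 2 + 1.28 := by
      rw [Real.sqrt_le_left (by positivity)]
      nlinarith
    rw [div_le_div_iff₀ (by positivity) (by positivity)]
    nlinarith
  have hE : 0.135 * (1 + 2 * u / x) ≤ Real.exp (-((2 * N + 1) / x)) := by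
    have h1 : Real.exp (-((2 * N + 1) / x)) = Real.exp (-2) * Real.exp (2 * u / x) := by
      rw [← Real.exp_add]
      congr 1
      rw [hu]
      field_simp
      ring
    rw [h1]
    have h2 := Real.add_one_le_exp (2 * u / x)
    have h3 := exp_neg_two_gt
    have : 0 < 2 * u / x := by positivity
    exact mul_le_mul h3.le (by linarith) (by linarith) (Real.exp_pos _).le
  have hEψ : 0.135 * (x + 2 * u) / (N + 2.14) ≤ Real.exp (-((2 * N + 1) / x))
        * (2 * x / (N + 3 / 2 + √((N + 3 / 2) ^ 2 + 8 * x / Real.pi))) := by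
    calc _ = 0.135 * (1 + 2 * u / x) * (x / (N + 2.14)) := by field_simp
      _ ≤ _ := mul_le_mul hE hψ (by positivity) (Real.exp_pos _).le
  have hu2 : u ≤ 1 / 2 := by linarith
  rcases (show N = 2 ∨ 3 ≤ N by omega) with rfl | hN3
  · have g0 : 5 / 13 ≤ amosF (2 : ℕ) x := by
      refine le_trans ?_ (div_le_amosF (by positivity) hx0)
      push_cast at *
      rw [div_le_div_iff₀ (by norm_num) (by positivity)]
      linarith
    have g1 : 5 / 17 ≤ amosF ((2 : ℕ) + 1) x := by
      refine le_trans ?_ (div_le_amosF (by positivity) hx0)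
      push_cast at *
      rw [div_le_div_iff₀ (by norm_num) (by positivity)]
      linarith
    have g2 : 5 / 21 ≤ amosF ((2 : ℕ) + 2) x := by
      refine le_trans ?_ (div_le_amosF (by positivity) hx0)
      push_cast at *
      rw [div_le_div_iff₀ (by norm_num) (by positivity)]
      linarith
    have hT : (5 / 13 : ℝ) * (5 / 17 * (5 / 21))
        ≤ amosF (2 : ℕ) x * (amosF ((2 : ℕ) + 1) x * amosF ((2 : ℕ) + 2) x) := by gcongr
    have hfin : u / ((2 : ℕ) + 3 / 2)
        ≤ 0.135 * (x + 2 * u) / ((2 : ℕ) + 2.14) + (5 / 13 : ℝ) * (5 / 17 * (5 / 21)) := by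
      push_cast at *
      rw [hxu]
      norm_num
      linarith
    linarith
  · have hN3' : (3 : ℝ) ≤ N := by exact_mod_cast hN3
    have hfin : u / (N + 3 / 2) ≤ 0.135 * (x + 2 * u) / (N + 2.14) := by
      rw [div_le_div_iff₀ (by positivity) (by positivity), hxu]
      nlinarith [mul_nonneg (sub_nonneg.2 hN3') (sub_nonneg.2 hu2),
        mul_nonneg (sub_nonneg.2 hN3') (sub_nonneg.2 hN3'), mul_nonneg (sub_nonneg.2 hN3') hu0.le]
    have : 0 < amosF N x * (amosF (N + 1) x * amosF (N + 2) x) := by positivity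
    linarith

theorem amosF_mul_besselRatio_le (n : ℕ) {x : ℝ} (hx : 0 < x) :
    amosF (n + 1) x * (besselI n x / besselI (0 : ℕ) x)
      ≤ besselI (n + 1 : ℕ) x / besselI (0 : ℕ) x := by
  have h0 := besselI_pos 0 hx
  have := amosF_mul_le_besselI n hx
  rw [← mul_div_assoc]
  gcongr

theorem sum_add_le_besselRatioSum (K : ℕ) {x : ℝ} (hx : 0 < x) :
    ∑ k ∈ Finset.range K,
          Real.exp (-(((k + 1 : ℕ) : ℝ) * (((k + 1 : ℕ) : ℝ) + 1) / (2 * x)))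
      + Real.exp (-((K : ℝ) * ((K : ℝ) + 1) / (2 * x)))
        * (amosF (K + 1) x * (1 + amosF (K + 2) x * (1 + amosF (K + 3) x)))
      ≤ besselRatioSum x := by
  have h0 := besselI_pos 0 hx
  have hA (n : ℕ) : Real.exp (-((n : ℝ) * (n + 1) / (2 * x)))
      ≤ besselI n x / besselI (0 : ℕ) x := by
    rw [le_div_iff₀ h0]
    exact exp_mul_besselI_zero_le n hx
  have hS := sum_le_hasSum (Finset.range (K + 3))
    (fun k _ => (div_pos (besselI_pos (k + 1) hx) h0).le) (hasSum_besselRatio hx)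
  rw [Finset.sum_range_succ, Finset.sum_range_succ, Finset.sum_range_succ] at hS
  have hsum : ∑ k ∈ Finset.range K,
          Real.exp (-(((k + 1 : ℕ) : ℝ) * (((k + 1 : ℕ) : ℝ) + 1) / (2 * x)))
      ≤ ∑ k ∈ Finset.range K, besselI (k + 1 : ℕ) x / besselI (0 : ℕ) x :=
    Finset.sum_le_sum fun k _ => hA (k + 1)
  have hF1 := amosF_pos (ν := K + 1) (by positivity) hx
  have hF2 := amosF_pos (ν := K + 2) (by positivity) hx
  have hF3 := amosF_pos (ν := K + 3) (by positivity) hx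
  have r1 := amosF_mul_besselRatio_le K hx
  have r2 := amosF_mul_besselRatio_le (K + 1) hx
  have r3 := amosF_mul_besselRatio_le (K + 1 + 1) hx
  rw [show ((K + 1 : ℕ) : ℝ) + 1 = K + 2 by push_cast; ring] at r2
  rw [show ((K + 1 + 1 : ℕ) : ℝ) + 1 = K + 3 by push_cast; ring] at r3
  have t1 := (mul_le_mul_of_nonneg_left (hA K) hF1.le).trans r1
  have t2 := (mul_le_mul_of_nonneg_left t1 hF2.le).trans r2
  have t3 := (mul_le_mul_of_nonneg_left t2 hF3.le).trans r3
  rw [show K + 2 + 1 = K + 1 + 1 + 1 by ring] at hS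
  linarith

theorem floor_eq_add_two {x : ℝ} (h : ⌊(0 : ℝ)⌋ + 2 ≤ ⌊x⌋) : ∃ K : ℕ, ⌊x⌋ = (K + 2 : ℕ) := by
  simp only [Int.floor_zero, zero_add] at h
  exact ⟨(⌊x⌋ - 2).toNat, by omega⟩

theorem lowerH_zero_eq {x : ℝ} {K : ℕ} (hK : ⌊x⌋ = (K + 2 : ℕ)) :
    lowerH 0 x = Real.exp (-((1 : ℝ) * (1 + 1) / (2 * x))) * millsRoot (3 / 2) x
      - 2 * x * Real.exp (-(((K : ℝ) + 3) * (K + 4) / (2 * x)))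
          / (K + 7 / 2 + √((K + 7 / 2) ^ 2 + 8 * x / Real.pi))
      + Real.exp (-(((K : ℝ) + 1) * (K + 2) / (2 * x)))
          * (amosF (K + 2) x * (1 + amosF (K + 3) x)) := by
  have h : ⌊(0 : ℝ)⌋ + 2 ≤ ⌊x⌋ := by rw [hK]; simp
  rw [lowerH, if_pos h, millsRoot]
  simp only [hK, Int.floor_zero, Int.fract_zero, Int.cast_zero]
  push_cast
  rw [show -(1 / x) * ((0 : ℝ) + 1) = -((1 : ℝ) * (1 + 1) / (2 * x)) by
      rcases eq_or_ne x 0 with rfl | hx <;> [simp; (field_simp; ring)],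
    show -(1 / (2 * x)) * (((K : ℝ) + 2 - 0 - 0 + 1) * (K + 2 + 0 - 0 + 2))
      = -(((K : ℝ) + 3) * (K + 4) / (2 * x)) by ring,
    show ((K : ℝ) + 2 - 0 - 1) * (K + 2 + 0 + 0) = (K + 1) * (K + 2) by ring,
    show (K : ℝ) + 2 + 3 / 2 = K + 7 / 2 by ring, show (K : ℝ) + 2 + 0 = K + 2 by ring,
    show (K : ℝ) + 2 + 1 = K + 3 by ring, zero_add]
  ring

theorem lowerH_zero_le_besselRatioSum {x : ℝ} (hx : 0 < x) : lowerH 0 x ≤ besselRatioSum x := by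
  by_cases h : ⌊(0 : ℝ)⌋ + 2 ≤ ⌊x⌋
  · obtain ⟨K, hK⟩ := floor_eq_add_two h
    have hx1 := Int.floor_le x
    have hx2 := Int.lt_floor_add_one x
    rw [hK] at hx1 hx2
    push_cast at hx1 hx2
    have hs := sum_add_le_besselRatioSum (K + 1) hx
    have hm := exp_mul_millsRoot_le_sum K (x := x) (by linarith)
    have hl := millsRoot_last_le (K + 2) (x := x) (by omega) (by push_cast; linarith)
      (by push_cast; linarith)
    rw [Finset.sum_range_succ] at hs
    push_cast at hs hm hl
    rw [lowerH_zero_eq hK]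
    have hE : Real.exp (-(((K : ℝ) + 3) * (K + 4) / (2 * x)))
        = Real.exp (-(((K : ℝ) + 1) * (K + 1 + 1) / (2 * x)))
          * Real.exp (-((2 * (K + 2) + 1) / x)) := by
      rw [← Real.exp_add]
      congr 1
      field_simp
      ring
    rw [hE]
    have hl' := mul_le_mul_of_nonneg_left hl
      (Real.exp_pos (-(((K : ℝ) + 1) * (K + 1 + 1) / (2 * x)))).le
    rw [show (K : ℝ) + 2 - 1 / 2 = K + 3 / 2 by ring, show (K : ℝ) + 2 + 3 / 2 = K + 7 / 2 by ring,
      show (K : ℝ) + 2 + 1 = K + 3 by ring, show (K : ℝ) + 2 + 2 = K + 4 by ring] at hl'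
    rw [show (K : ℝ) + 1 + 1 = K + 2 by ring, show (K : ℝ) + 1 + 2 = K + 3 by ring,
      show (K : ℝ) + 1 + 3 = K + 4 by ring] at *
    generalize (K : ℝ) + 7 / 2 + √((K + 7 / 2) ^ 2 + 8 * x / Real.pi) = D at *
    generalize Real.exp (-((K + 1) * (K + 2) / (2 * x))) = E at *
    generalize Real.exp (-((2 * (K + 2) + 1) / x)) = E' at *
    generalize Real.exp (-((1 : ℝ) * (1 + 1) / (2 * x))) = E₁ at *
    linear_combination hs + hm + hl'
  · rw [lowerH, if_neg h]
    have hs := sum_add_le_besselRatioSum 0 hx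
    have hF1 := amosF_pos (ν := 0 + 1) (by positivity) hx
    have hF2 := amosF_pos (ν := 0 + 2) (by positivity) hx
    have hF3 := amosF_pos (ν := 0 + 3) (by positivity) hx
    simp only [Finset.range_zero, Finset.sum_empty, Nat.cast_zero, zero_mul, zero_div, neg_zero,
      Real.exp_zero, one_mul, zero_add] at *
    have : 0 < amosF 1 x * (amosF 2 x * amosF 3 x) := by positivity
    linarith

/-- The only negative term of `lowerH 0 x` is smaller than `1 / 2` in absolute value. -/
theorem one_add_two_mul_lowerH_pos {x : ℝ} (hx : 0 < x) : 0 < 1 + 2 * lowerH 0 x := by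
  by_cases h : ⌊(0 : ℝ)⌋ + 2 ≤ ⌊x⌋
  · obtain ⟨K, hK⟩ := floor_eq_add_two h
    have hx2 := Int.lt_floor_add_one x
    rw [hK] at hx2
    push_cast at hx2
    have hK0 : (0 : ℝ) ≤ K := by positivity
    rw [lowerH_zero_eq hK]
    have h1 := millsRoot_pos (a := 3 / 2) (by norm_num) hx
    have h2 := amosF_pos (ν := K + 2) (by positivity) hx
    have h3 := amosF_pos (ν := K + 3) (by positivity) hx
    have h4 : 2 * x * Real.exp (-(((K : ℝ) + 3) * (K + 4) / (2 * x)))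
          / (K + 7 / 2 + √((K + 7 / 2) ^ 2 + 8 * x / Real.pi)) < 1 / 2 := by
      have hs : (K : ℝ) + 7 / 2 ≤ √((K + 7 / 2) ^ 2 + 8 * x / Real.pi) :=
        Real.le_sqrt_of_sq_le (by have : 0 ≤ 8 * x / Real.pi := by positivity
                                  linarith)
      have he : Real.exp (-(((K : ℝ) + 3) * (K + 4) / (2 * x))) < 1 / 2 := by
        have : (1 : ℝ) < ((K : ℝ) + 3) * (K + 4) / (2 * x) := by
          rw [lt_div_iff₀ (by positivity)]
          nlinarith
        have h5 := Real.add_one_le_exp (((K : ℝ) + 3) * (K + 4) / (2 * x))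
        rw [Real.exp_neg, one_div]
        exact inv_strictAnti₀ (by norm_num) (by linarith)
      rw [div_lt_iff₀ (by positivity)]
      have : 2 * x * Real.exp (-(((K : ℝ) + 3) * (K + 4) / (2 * x))) < 2 * x * (1 / 2) := by
        gcongr
      linarith
    have h5 : 0 < Real.exp (-((1 : ℝ) * (1 + 1) / (2 * x))) * millsRoot (3 / 2) x := by positivity
    have h6 : 0 < Real.exp (-(((K : ℝ) + 1) * (K + 2) / (2 * x)))
          * (amosF (K + 2) x * (1 + amosF (K + 3) x)) := by positivity
    linarith
  · rw [lowerH, if_neg h]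
    have hF1 := amosF_pos (ν := 0 + 1) (by positivity) hx
    have hF2 := amosF_pos (ν := 0 + 2) (by positivity) hx
    positivity

/-! ### The bounds for `e ^ (-x) I_ν(x)` -/

theorem inv_le_exp_neg_mul_besselI_zero {x : ℝ} (hx : 0 < x) :
    1 / (1 + 2 * upperH 0 x) ≤ Real.exp (-x) * besselI (0 : ℕ) x := by
  have h0 := besselI_pos 0 hx
  have hpos : 0 < 1 + 2 * besselRatioSum x := by
    rw [← one_div_pos, ← exp_neg_mul_besselI_zero hx]
    positivity
  have := besselRatioSum_le_upperH hx
  rw [exp_neg_mul_besselI_zero hx]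
  gcongr

theorem exp_neg_mul_besselI_zero_le_inv {x : ℝ} (hx : 0 < x) :
    Real.exp (-x) * besselI (0 : ℕ) x ≤ 1 / (1 + 2 * lowerH 0 x) := by
  have hpos := one_add_two_mul_lowerH_pos hx
  have := lowerH_zero_le_besselRatioSum hx
  rw [exp_neg_mul_besselI_zero hx]
  gcongr

theorem gauss_bounds (ν : ℕ) {x : ℝ} (hx : 0 < x) :
    gaussLower ν x ≤ Real.exp (-x) * besselI ν x ∧
      ((ν : ℝ) ≤ x → Real.exp (-x) * besselI ν x ≤ gaussUpper ν x) := by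
  constructor
  · calc gaussLower ν x = Real.exp (-((ν : ℝ) * (ν + 1) / (2 * x)))
          * (1 / (1 + 2 * upperH 0 x)) := by rw [gaussLower]; ring
      _ ≤ Real.exp (-((ν : ℝ) * (ν + 1) / (2 * x))) * (Real.exp (-x) * besselI (0 : ℕ) x) := by
        have := inv_le_exp_neg_mul_besselI_zero hx
        gcongr
      _ = Real.exp (-x) *
          (Real.exp (-((ν : ℝ) * (ν + 1) / (2 * x))) * besselI (0 : ℕ) x) := by ring
      _ ≤ _ := by
        have := exp_mul_besselI_zero_le ν hx
        gcongr
  · intro hν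
    calc _ ≤ Real.exp (-x) *
          (Real.exp (-(alphaZero * (ν : ℝ) ^ 2 / (2 * x))) * besselI (0 : ℕ) x) := by
          have := besselI_le_exp_mul ν hx hν
          gcongr
      _ = Real.exp (-(alphaZero * (ν : ℝ) ^ 2 / (2 * x)))
          * (Real.exp (-x) * besselI (0 : ℕ) x) := by ring
      _ ≤ Real.exp (-(alphaZero * (ν : ℝ) ^ 2 / (2 * x))) * (1 / (1 + 2 * lowerH 0 x)) := by
        have := exp_neg_mul_besselI_zero_le_inv hx
        gcongr
      _ = _ := by rw [gaussUpper]; ring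

theorem beta_bounds (ν : ℕ) {x : ℝ} (hx : 0 < x) (hν : x < ν) :
    betaLower ν x ≤ Real.exp (-x) * besselI ν x ∧
      Real.exp (-x) * besselI ν x ≤ betaUpper ν x := by
  have hN : ⌊x⌋₊ < ν := (Nat.floor_lt hx.le).2 hν
  have hNx := Nat.floor_le hx.le
  rw [betaLower, betaUpper]
  generalize ⌊x⌋₊ = N at *
  obtain ⟨d, rfl⟩ := Nat.exists_eq_add_of_le hN.le
  have hd : 0 < d := by omega
  have hsub : ((N + d : ℕ) : ℝ) - N = d := by push_cast; ring
  rw [hsub, Nat.add_sub_cancel_left]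
  have hg := gauss_bounds N hx
  constructor
  · have hG : 0 ≤ Real.Gamma (N + x / 2 + 1) / Real.Gamma (N + x / 2 + 1 + d) * (x / 2) ^ d := by
      have := Real.Gamma_pos_of_pos (show 0 < (N : ℝ) + x / 2 + 1 by positivity)
      have := Real.Gamma_pos_of_pos (show 0 < (N : ℝ) + x / 2 + 1 + d by positivity)
      positivity
    calc _ = Real.Gamma (N + x / 2 + 1) / Real.Gamma (N + x / 2 + 1 + d) * (x / 2) ^ d
          * gaussLower N x := by rw [← beta_div_factorial _ hd, gaussLower]; ring
      _ ≤ Real.Gamma (N + x / 2 + 1) / Real.Gamma (N + x / 2 + 1 + d) * (x / 2) ^ d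
          * (Real.exp (-x) * besselI N x) := mul_le_mul_of_nonneg_left hg.1 hG
      _ = Real.exp (-x) * (Real.Gamma (N + x / 2 + 1) / Real.Gamma (N + x / 2 + 1 + d)
          * (x / 2) ^ d * besselI N x) := by ring
      _ ≤ _ := mul_le_mul_of_nonneg_left (Gamma_div_mul_besselI_le N d hx) (Real.exp_pos _).le
  · have hG : 0 ≤ Real.Gamma (N + x + 1 / 2) / Real.Gamma (N + x + 1 / 2 + d) * x ^ d := by
      have := Real.Gamma_pos_of_pos (show 0 < (N : ℝ) + x + 1 / 2 by positivity)
      have := Real.Gamma_pos_of_pos (show 0 < (N : ℝ) + x + 1 / 2 + d by positivity)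
      positivity
    calc _ ≤ Real.exp (-x) * (Real.Gamma (N + x + 1 / 2) / Real.Gamma (N + x + 1 / 2 + d)
          * x ^ d * besselI N x) :=
          mul_le_mul_of_nonneg_left (besselI_le_Gamma_div_mul N d hx) (Real.exp_pos _).le
      _ = Real.Gamma (N + x + 1 / 2) / Real.Gamma (N + x + 1 / 2 + d) * x ^ d
          * (Real.exp (-x) * besselI N x) := by ring
      _ ≤ Real.Gamma (N + x + 1 / 2) / Real.Gamma (N + x + 1 / 2 + d) * x ^ d
          * gaussUpper N x := mul_le_mul_of_nonneg_left (hg.2 hNx) hG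
      _ = _ := by rw [← beta_div_factorial _ hd, gaussUpper]; ring

theorem besselI_zero_right (n : ℕ) : besselI n 0 = if n = 0 then 1 else 0 := by
  rw [besselI_natCast, tsum_eq_single 0]
  · rcases n with - | n <;> simp
  · intro k hk
    simp [hk]

/-- At `x = 0` the exponents `0 / 0` are `0` in Lean, which is how they are to be read here. -/
theorem bessel_bounds_at_zero (ν : ℕ) :
    ((ν : ℝ) ≤ 0 →
        gaussLower ν 0 ≤ Real.exp (-0) * besselI ν 0 ∧
          Real.exp (-0) * besselI ν 0 ≤ gaussUpper ν 0) ∧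
      ((0 : ℝ) < ν →
        betaLower ν 0 ≤ Real.exp (-0) * besselI ν 0 ∧
          Real.exp (-0) * besselI ν 0 ≤ betaUpper ν 0) := by
  constructor
  · intro h
    obtain rfl : ν = 0 := by exact_mod_cast le_antisymm h (by positivity)
    have h0 : besselI 0 0 = 1 := by simpa using besselI_zero_right 0
    simp [h0, gaussLower, gaussUpper, lowerH, upperH, amosF]
  · intro h
    have hν : ν ≠ 0 := by rintro rfl; simp at h
    simp [besselI_zero_right, betaLower, betaUpper, hν]

theorem theorem2 (ν : ℕ) :
    (∀ x : ℝ, 0 ≤ x →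
      ((ν : ℝ) ≤ x →
        gaussLower ν x ≤ Real.exp (-x) * besselI ν x ∧
          Real.exp (-x) * besselI ν x ≤ gaussUpper ν x) ∧
      (x < (ν : ℝ) →
        betaLower ν x ≤ Real.exp (-x) * besselI ν x ∧
          Real.exp (-x) * besselI ν x ≤ betaUpper ν x)) ∧
    (∀ a b : ℝ≥0, 0 < a → 0 < b → ∀ x : ℝ, x = 2 * √((a : ℝ) * b) →
      ((ν : ℝ) ≤ x →
        skellamFactor a b ν * gaussLower ν x ≤ (skellamMeasure a b).real {(ν : ℤ)} ∧
          (skellamMeasure a b).real {(ν : ℤ)} ≤ skellamFactor a b ν * gaussUpper ν x) ∧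
      (x < (ν : ℝ) →
        skellamFactor a b ν * betaLower ν x ≤ (skellamMeasure a b).real {(ν : ℤ)} ∧
          (skellamMeasure a b).real {(ν : ℤ)} ≤ skellamFactor a b ν * betaUpper ν x)) := by
  refine ⟨fun x hx => ?_, fun a b ha hb x hx => ?_⟩
  · rcases hx.eq_or_lt with rfl | hx
    · exact bessel_bounds_at_zero ν
    · exact ⟨fun h => ⟨(gauss_bounds ν hx).1, (gauss_bounds ν hx).2 h⟩, beta_bounds ν hx⟩
  · have hx0 : 0 < x := by
      have ha' : (0 : ℝ) < a := ha
      have hb' : (0 : ℝ) < b := hb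
      rw [hx]
      positivity
    have hF : 0 ≤ skellamFactor a b ν := by unfold skellamFactor; positivity
    rw [skellamMeasure_real_eq a b ha hb ν, ← hx]
    refine ⟨fun h => ?_, fun h => ?_⟩
    · exact ⟨mul_le_mul_of_nonneg_left (gauss_bounds ν hx0).1 hF,
        mul_le_mul_of_nonneg_left ((gauss_bounds ν hx0).2 h) hF⟩
    · exact ⟨mul_le_mul_of_nonneg_left (beta_bounds ν hx0 h).1 hF,
        mul_le_mul_of_nonneg_left (beta_bounds ν hx0 h).2 hF⟩
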